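/- **Setting.** Systems $A,B,\dots$ are finite-dimensional (dimension $\ge 1$); $I$ is the one-dimensional system. *Types* are generated as follows. Every string $A_1\cdots A_n$ of systems is a type, every $(\hat Xu\to\hat Yv)$ with systems $X,Y$ and strings of systems $u,v$ is a type (these two kinds are the elementary types), and if $x,y$ are types, so is $(x\to y)$. Each type has a Hilbert space $\mathcal H_x$: $\mathcal H_{A_1\cdots A_n}=\bigotimes_i\mathcal H_{A_i}$, $\mathcal H_{\hat Xu\to\hat Yv}=\mathcal H_X\otimes\mathcal H_u\otimes\mathcal H_Y\otimes\mathcal H_v$, $\mathcal H_{x\to y}=\mathcal H_x\otimes\mathcal H_y$ (different occurrences of systems count as different tensor factors). An operator $M$ on $\mathcal H_{x\to y}$ is identified with the linear map $\mathcal M(O)=\operatorname{Tr}_x[(O^T\otimes\mathbb 1_y)M]$ of which it is the Choi operator. For a system $E$, the extension $x\,\|\,E$ appends $E$ to the string $x$, to the string $v$ if $x=(\hat Xu\to\hat Yv)$, and $(y\to z)\,\|\,E=y\to(z\,\|\,E)$. Put $\overline x=x\to I$ and $x\otimes y=\overline{x\to\overline y}$. The set $\mathsf T_1(x)$ of *deterministic*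 events and the set $T(x)$ of *admissible* events of type $x$ are sets of operators on $\mathcal H_x$, defined recursively. * $\mathsf T_1(A_1\cdots A_n)$ consists of the $M\ge0$ with $\operatorname{Tr}M=1$. $\mathsf T_1(\hat Xu\to\hat Yv)$ consists of the $M\ge 0$ with $\operatorname{Tr}_{Yv}M=\mathbb 1_{Xu}$ and $\operatorname{Tr}_{Xv}M=\mathbb 1_{Yu}$. For these elementary types, $M\in T(x)$ iff $0\le M\le D$ for some $D\in\mathsf T_1(x)$. * $M\in\mathsf T_1(x\to y)$ iff, for every system $E$, $\mathcal M\otimes\mathcal I_E$ maps $T(x\|E)$ into $T(y\|E)$ and $\mathsf T_1(x\|E)$ into $\mathsf T_1(y\|E)$. * $M\in T(x\to y)$ iff (i) for every $E$, $\mathcal M\otimes\mathcal I_E$ maps $T(x\|E)$ into $T(y\|E)$, and (ii) there are finitely many (possibly no) operators $N_1,\dots,N_n$ on $\mathcal H_{x\to y}$, each satisfying (i), with $M+\sum_iN_i\in\mathsf T_1(x\to y)$. For operators $R$ on $\mathcal H_K\otimes\mathcal H_B$ and $S$ on $\mathcal H_B\otimes\mathcal H_L$, where $B$ collects all the tensor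 factors that they share, the *link product* is $R*S=\operatorname{Tr}_B[(\mathbb 1_K\otimes S^{T_B})(R\otimes\mathbb 1_L)]$, an operator on $\mathcal H_K\otimes\mathcal H_L$ (tensor factors are reordered, and one-dimensional factors $\mathcal H_I$ inserted or dropped, as needed). **Statement.** 1. Let $x,y$ be types and $A,B,C$ systems or strings of systems. If $R\in\mathsf T_1(x\to(A\to B))$ and $S\in\mathsf T_1(y\to(B\to C))$, then the link product over $B$ satisfies $$R*S\in\mathsf T_1\bigl((x\otimes y)\to(A\to C)\bigr).$$ 2. Consequently, networks of higher-order maps are admissible events: let $n\ge1$, let $x_1,\dots,x_n$ be types and $E_0,\dots,E_n$ systems or strings of systems, and let $M_i\in\mathsf T_1(\overline{x_i}\to(E_{i-1}\to E_i))$ for $i=1,\dots,n$. Then the operator $M_1*M_2*\cdots*M_n$ is a deterministic, and hence admissible, event of type $z=(\overline{x_1}\otimes\cdots\otimes\overline{x_n})\to(E_0\to E_n)$ (tensor product bracketed to the left), i.e. $M_1*\cdots*M_n\in\mathsf T_1(z)\subseteq T(z)$. -/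

import Mathlib

open Matrix
open scoped Kronecker ComplexOrder

namespace HigherOrder

/-! ## Operators on tensor products of finite-dimensional spaces

The Hilbert space with orthonormal basis indexed by a finite type `K` is `ℂ^K`, operators on it are
matrices `Matrix K K ℂ`, and the space indexed by `K × L` is the tensor product of those indexed
by `K` and by `L`. -/

section Operators

variable {K B L : Type} [Fintype K] [Fintype B] [Fintype L]
  [DecidableEq K] [DecidableEq B] [DecidableEq L]

/-- Partial trace over the first tensor factor. -/
def trFst (M : Matrix (K × L) (K × L) ℂ) : Matrix L L ℂ :=
  Matrix.of fun l l' => ∑ k, M (k, l) (k, l')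

/-- Partial trace over the second tensor factor. -/
def trSnd (M : Matrix (K × L) (K × L) ℂ) : Matrix K K ℂ :=
  Matrix.of fun k k' => ∑ l, M (k, l) (k', l)

/-- Partial trace over the middle one of three tensor factors. -/
def trMid (M : Matrix (K × (B × L)) (K × (B × L)) ℂ) : Matrix (K × L) (K × L) ℂ :=
  Matrix.of fun p q => ∑ b, M (p.1, (b, p.2)) (q.1, (b, q.2))

/-- Partial transpose on the first tensor factor. -/
def transposeFst (M : Matrix (B × L) (B × L) ℂ) : Matrix (B × L) (B × L) ℂ :=
  Matrix.of fun p q => M (q.1, p.2) (p.1, q.2)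

/-- The link product `N * M = Tr_B[(𝟙_K ⊗ M^{T_B}) (N ⊗ 𝟙_L)]` of an operator `N` on `K ⊗ B` with an
operator `M` on `B ⊗ L`, where `B` is the collection of all the tensor factors that the two
operators share; it is an operator on `K ⊗ L`. -/
def link (N : Matrix (K × B) (K × B) ℂ) (M : Matrix (B × L) (B × L) ℂ) :
    Matrix (K × L) (K × L) ℂ :=
  trMid (((1 : Matrix K K ℂ) ⊗ₖ transposeFst M) *
    Matrix.reindex (Equiv.prodAssoc K B L) (Equiv.prodAssoc K B L)
      (N ⊗ₖ (1 : Matrix L L ℂ)))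

/-- The map `O ↦ Tr_K[(Oᵀ ⊗ 𝟙_L) M]` with Choi operator `M`. -/
def choiInv (M : Matrix (K × L) (K × L) ℂ) (O : Matrix K K ℂ) : Matrix L L ℂ :=
  trFst ((Oᵀ ⊗ₖ (1 : Matrix L L ℂ)) * M)

/-- The extension `Φ ⊗ id` of a map `Φ` on operators by the identity map on the operators of the
system `B`: it applies `Φ` to each of the blocks of an operator on `K ⊗ B`. -/
def ampliate (Φ : Matrix K K ℂ → Matrix L L ℂ) (O : Matrix (K × B) (K × B) ℂ) :
    Matrix (L × B) (L × B) ℂ :=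
  Matrix.of fun p q => Φ (Matrix.of fun k k' => O (k, p.2) (k', q.2)) p.1 q.1

end Operators

/-- `R` is (the Choi operator of) a channel from `X ⊗ A` to `Y ⊗ B` that is `X`-`Y` bistochastic:
`R ≥ 0`, `Tr_{YB} R = 𝟙_{XA}`, and `Tr_{XB} R = 𝟙_{AY}`, the last one entrywise. -/
def IsBistochasticChannel {X A Y B : Type} [Fintype X] [Fintype A] [Fintype Y] [Fintype B]
    [DecidableEq X] [DecidableEq A] [DecidableEq Y] [DecidableEq B]
    (R : Matrix ((X × A) × (Y × B)) ((X × A) × (Y × B)) ℂ) : Prop :=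
  R.PosSemidef ∧ trSnd R = 1 ∧
    (Matrix.of fun (p q : A × Y) =>
      ∑ t : X × B, R ((t.1, p.1), (p.2, t.2)) ((t.1, q.1), (q.2, t.2))) = 1

/-! ## Systems and types -/

/-- A finite-dimensional quantum system, given by the dimension of its Hilbert space. -/
structure Sys where
  dim : ℕ
  dim_pos : 0 < dim

/-- The trivial system. -/
def Sys.triv : Sys := ⟨1, Nat.one_pos⟩

/-- The index set of the product basis of a string `A₁A₂…Aₙ` of systems. -/
@[reducible] def StrIdx : List Sys → Type
  | [] => Unit
  | A :: w => Fin A.dim × StrIdx w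

instance StrIdx.instFintype : (w : List Sys) → Fintype (StrIdx w)
  | [] => inferInstanceAs (Fintype Unit)
  | A :: w => @instFintypeProd (Fin A.dim) (StrIdx w) _ (StrIdx.instFintype w)

instance StrIdx.instDecidableEq : (w : List Sys) → DecidableEq (StrIdx w)
  | [] => inferInstanceAs (DecidableEq Unit)
  | A :: w => @instDecidableEqProd (Fin A.dim) (StrIdx w) _ (StrIdx.instDecidableEq w)

/-- Appending a system to a string adds a last tensor factor. -/
def snocEquiv (E : Sys) : (w : List Sys) → StrIdx (w ++ [E]) ≃ StrIdx w × Fin E.dim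
  | [] => Equiv.prodComm (Fin E.dim) Unit
  | A :: w =>
    (Equiv.prodCongr (Equiv.refl (Fin A.dim)) (snocEquiv E w)).trans
      (Equiv.prodAssoc (Fin A.dim) (StrIdx w) (Fin E.dim)).symm

/-- Types of higher-order maps. Elementary types are the strings `A₁A₂…Aₙ` of systems and the types
`(X̂u → Ŷv)`, with `u` and `v` strings of systems, of partially bistochastic channels. -/
inductive Ty where
  | str (w : List Sys) : Ty
  | bist (X : Sys) (u : List Sys) (Y : Sys) (v : List Sys) : Ty
  | arr (x y : Ty) : Ty

namespace Ty

/-- The trivial type `I`. -/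
def triv : Ty := str [Sys.triv]

/-- The type `x̄ = x → I` of functionals on `x`. -/
def bar (x : Ty) : Ty := arr x triv

/-- The type `x ⊗ y`, the functionals on `x → ȳ`. -/
def tensor (x y : Ty) : Ty := bar (arr x (bar y))

/-- The extension `x ∥ E` of the type `x` by the system `E`. -/
def ext : Ty → Sys → Ty
  | str w, E => str (w ++ [E])
  | bist X u Y v, E => bist X u Y (v ++ [E])
  | arr x y, E => arr x (ext y E)

/-- The number of nested arrows. -/
def depth : Ty → ℕ
  | str _ => 0
  | bist _ _ _ _ => 0
  | arr x y => max x.depth y.depth + 1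

theorem depth_ext (x : Ty) (E : Sys) : (x.ext E).depth = x.depth := by
  induction x with
  | str w => rfl
  | bist X u Y v => rfl
  | arr x y _ ih => simp [ext, depth, ih]

/-- The index set of the product basis of the Hilbert space `H_x` of the type `x`: each occurrence
of a system in `x` is a tensor factor of its own. -/
@[reducible] def Idx : Ty → Type
  | str w => StrIdx w
  | bist X u Y v => (Fin X.dim × StrIdx u) × (Fin Y.dim × StrIdx v)
  | arr x y => Idx x × Idx y

instance instFintypeIdx : (x : Ty) → Fintype x.Idx
  | str w => StrIdx.instFintype w
  | bist X u Y v =>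
    inferInstanceAs (Fintype ((Fin X.dim × StrIdx u) × (Fin Y.dim × StrIdx v)))
  | arr x y => @instFintypeProd x.Idx y.Idx (instFintypeIdx x) (instFintypeIdx y)

instance instDecidableEqIdx : (x : Ty) → DecidableEq x.Idx
  | str w => StrIdx.instDecidableEq w
  | bist X u Y v =>
    inferInstanceAs (DecidableEq ((Fin X.dim × StrIdx u) × (Fin Y.dim × StrIdx v)))
  | arr x y => @instDecidableEqProd x.Idx y.Idx (instDecidableEqIdx x) (instDecidableEqIdx y)

/-- The extension by `E` adds a last tensor factor. -/
def extEquiv (E : Sys) : (x : Ty) → (x.ext E).Idx ≃ x.Idx × Fin E.dim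
  | str w => snocEquiv E w
  | bist X u Y v =>
    (Equiv.prodCongr (Equiv.refl (Fin X.dim × StrIdx u))
      ((Equiv.prodCongr (Equiv.refl (Fin Y.dim)) (snocEquiv E v)).trans
        (Equiv.prodAssoc (Fin Y.dim) (StrIdx v) (Fin E.dim)).symm)).trans
      (Equiv.prodAssoc (Fin X.dim × StrIdx u) (Fin Y.dim × StrIdx v) (Fin E.dim)).symm
  | arr x y =>
    (Equiv.prodCongr (Equiv.refl x.Idx) (extEquiv E y)).trans
      (Equiv.prodAssoc x.Idx y.Idx (Fin E.dim)).symm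

end Ty

/-- Generalized events of type `x`: all linear operators on `H_x`. A generalized event of type
`x → y` is the Choi operator of a linear map from the operators on `H_x` to those on `H_y`. -/
abbrev Op (x : Ty) : Type := Matrix x.Idx x.Idx ℂ

/-- The map `ℳ ⊗ id_E` from the generalized events of type `x ∥ E` to those of type `y ∥ E`, where
`ℳ` is the map whose Choi operator is `M`. -/
def extMap {x y : Ty} (M : Op (Ty.arr x y)) (E : Sys) (O : Op (x.ext E)) : Op (y.ext E) :=
  Matrix.reindex (Ty.extEquiv E y).symm (Ty.extEquiv E y).symm
    (ampliate (choiInv M) (Matrix.reindex (Ty.extEquiv E x) (Ty.extEquiv E x) O))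

/-! ## Deterministic and admissible events -/

mutual

/-- The set `T₁(x)` of the deterministic events of type `x`. -/
def Det : (x : Ty) → Set (Op x)
  | .str _ => {M | M.PosSemidef ∧ M.trace = 1}
  | .bist _ _ _ _ => {M | IsBistochasticChannel M}
  | .arr x y => {M | ∀ E : Sys,
      (∀ O ∈ Adm (x.ext E), extMap M E O ∈ Adm (y.ext E)) ∧
      (∀ O ∈ Det (x.ext E), extMap M E O ∈ Det (y.ext E))}
termination_by x => 2 * x.depth
decreasing_by all_goals (simp only [Ty.depth_ext, Ty.depth]; omega)

/-- The set `T(x)` of the admissible events of type `x`. -/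
def Adm : (x : Ty) → Set (Op x)
  | .str w => {M | M.PosSemidef ∧ ∃ D ∈ Det (.str w), (D - M).PosSemidef}
  | .bist X u Y v => {M | M.PosSemidef ∧ ∃ D ∈ Det (.bist X u Y v), (D - M).PosSemidef}
  | .arr x y => {M |
      (∀ E : Sys, ∀ O ∈ Adm (x.ext E), extMap M E O ∈ Adm (y.ext E)) ∧
      ∃ (n : ℕ) (N : Fin n → Op (Ty.arr x y)),
        (∀ i, ∀ E : Sys, ∀ O ∈ Adm (x.ext E), extMap (N i) E O ∈ Adm (y.ext E)) ∧
        (∀ E : Sys, ∀ O ∈ Adm (x.ext E), extMap (M + ∑ i, N i) E O ∈ Adm (y.ext E)) ∧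
        (∀ E : Sys, ∀ O ∈ Det (x.ext E), extMap (M + ∑ i, N i) E O ∈ Det (y.ext E))}
termination_by x => 2 * x.depth + 1
decreasing_by all_goals (simp only [Ty.depth_ext, Ty.depth]; omega)

end

/-! ## Composition of higher-order maps and networks -/

/-- The type `x → (A → B)`, with `A` and `B` strings of systems. -/
abbrev toChan (x : Ty) (A B : List Sys) : Ty := Ty.arr x (Ty.arr (Ty.str A) (Ty.str B))

/-- The order of the tensor factors of `(x ⊗ A) ⊗ (y ⊗ C)` in the type `(x ⊗ y) → (A → C)`, whose two
trivial systems `I` are one-dimensional tensor factors. -/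
def compEquiv (x y : Ty) (A C : List Sys) :
    (x.Idx × StrIdx A) × (y.Idx × StrIdx C) ≃ (toChan (Ty.tensor x y) A C).Idx where
  toFun p := (((p.1.1, (p.2.1, ((0 : Fin 1), ()))), ((0 : Fin 1), ())), (p.1.2, p.2.2))
  invFun q := ((q.1.1.1, q.2.1), (q.1.1.2.1, q.2.2))
  left_inv _ := rfl
  right_inv := by
    rintro ⟨⟨⟨a, b, i, u⟩, j, v⟩, c, d⟩
    have hi : (0 : Fin 1) = i := Subsingleton.elim (α := Fin 1) _ _
    have hj : (0 : Fin 1) = j := Subsingleton.elim (α := Fin 1) _ _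
    subst hi hj
    rfl

/-- The link product `R * S` over the shared system `B` of operators `R` of type `x → (A → B)` and `S`
of type `y → (B → C)`, with its tensor factors `x, A, y, C` in the order of `(x ⊗ y) → (A → C)`. -/
def linkComp {x y : Ty} {A B C : List Sys} (R : Op (toChan x A B)) (S : Op (toChan y B C)) :
    Op (toChan (Ty.tensor x y) A C) :=
  Matrix.reindex (compEquiv x y A C) (compEquiv x y A C)
    (link
      (Matrix.reindex (Equiv.prodAssoc x.Idx (StrIdx A) (StrIdx B)).symm
        (Equiv.prodAssoc x.Idx (StrIdx A) (StrIdx B)).symm R)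
      (Matrix.reindex
        ((Equiv.prodAssoc (StrIdx B) y.Idx (StrIdx C)).symm.trans
          ((Equiv.prodCongr (Equiv.prodComm (StrIdx B) y.Idx) (Equiv.refl (StrIdx C))).trans
            (Equiv.prodAssoc y.Idx (StrIdx B) (StrIdx C)))).symm
        ((Equiv.prodAssoc (StrIdx B) y.Idx (StrIdx C)).symm.trans
          ((Equiv.prodCongr (Equiv.prodComm (StrIdx B) y.Idx) (Equiv.refl (StrIdx C))).trans
            (Equiv.prodAssoc y.Idx (StrIdx B) (StrIdx C)))).symm S))

/-- The type `t₀ ⊗ t₁ ⊗ ⋯ ⊗ tₙ`, bracketed to the left. -/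
def tensorSeq (t : ℕ → Ty) : ℕ → Ty
  | 0 => t 0
  | n + 1 => Ty.tensor (tensorSeq t n) (t (n + 1))

/-- The network `M₀ * M₁ * ⋯ * Mₙ` of operators `Mᵢ` of types `tᵢ → (Eᵢ → Eᵢ₊₁)`. -/
def network {t : ℕ → Ty} {E : ℕ → List Sys} (M : ∀ i, Op (toChan (t i) (E i) (E (i + 1)))) :
    (n : ℕ) → Op (toChan (tensorSeq t n) (E 0) (E (n + 1)))
  | 0 => M 0
  | n + 1 => linkComp (network M n) (M (n + 1))

end HigherOrder

set_option linter.unusedSectionVars false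

-- The definition of events quantifies over all extensions and allows degenerate types, so the first
-- task is a structure theorem, `Ty.trichotomy`: together with all its extensions, every type is
-- void, full or regular. Voidness starts at `bist X u Y v` with `X.dim ≠ Y.dim` and spreads through
-- arrows: void → anything and anything → full are full; full → regular, and anything nonvoid →
-- void, are void; regular → regular is regular. Between regular types,
-- `mem_det_arr_iff_of_isRegular` removes the extensions: a deterministic event is a positive Choi
-- operator sending deterministic events to deterministic events. This is Choi's theorem, tested on
-- a small multiple of the maximally entangled projector.
--
-- For regular `x` and `y`, the link product L of R and S is positive, so only a normalization
-- remains: for T deterministic of type `x ⊗ y` and a state a on A, the output L(T)(a) must have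
-- trace 1. That number is T, a functional on `x → ȳ`, evaluated at L * (a ⊗ 𝟙_C). The latter is
-- deterministic of type `x → ȳ`, because on ρ and σ it gives Tr S(σ)(R(ρ)(a)) = 1, a composition of
-- channels applied to a state. If x or y is void, then `x → ȳ` is full, `x ⊗ y` is void and the
-- claim is vacuous; if one is full, R or S cannot exist. Networks follow by induction.

namespace HigherOrder

-- Positivity and partial traces of Choi operators and link products

section Operators

variable {K B L : Type} [Fintype K] [Fintype B] [Fintype L]
  [DecidableEq K] [DecidableEq B] [DecidableEq L]

theorem choiInv_apply (M : Matrix (K × L) (K × L) ℂ) (O : Matrix K K ℂ) (l l' : L) :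
    choiInv M O l l' = ∑ k, ∑ k', O k k' * M (k, l) (k', l') := by
  simp only [choiInv, trFst, Matrix.of_apply, Matrix.mul_apply, Fintype.sum_prod_type,
    kroneckerMap_apply, transpose_apply, Matrix.one_apply, mul_ite, mul_one, mul_zero, ite_mul,
    zero_mul, Finset.sum_ite_eq, Finset.mem_univ, if_true]
  exact Finset.sum_comm

theorem ampliate_choiInv_apply (M : Matrix (K × L) (K × L) ℂ) (O : Matrix (K × B) (K × B) ℂ)
    (p q : L × B) :
    ampliate (choiInv M) O p q =
      ∑ k, ∑ k', O (k, p.2) (k', q.2) * M (k, p.1) (k', q.1) := by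
  simp only [ampliate, Matrix.of_apply, choiInv_apply]

theorem link_apply (N : Matrix (K × B) (K × B) ℂ) (M : Matrix (B × L) (B × L) ℂ) (p q : K × L) :
    link N M p q = ∑ b, ∑ b', N (p.1, b) (q.1, b') * M (b, p.2) (b', q.2) := by
  simp only [link, trMid, Matrix.of_apply, Matrix.mul_apply, Fintype.sum_prod_type,
    kroneckerMap_apply, transposeFst, Matrix.one_apply, reindex_apply, submatrix_apply,
    Equiv.prodAssoc_symm_apply, mul_ite, mul_one, mul_zero, ite_mul, one_mul,
    zero_mul, Finset.sum_ite_eq', Finset.mem_univ, if_true]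
  rw [Finset.sum_comm]
  simp only [Finset.sum_ite_irrel, Finset.sum_const_zero, Finset.sum_ite_eq, Finset.mem_univ,
    if_true, mul_comm]
  exact Finset.sum_comm

/-- Contracting a tensor factor with the maximally entangled vector preserves positivity. -/
theorem posSemidef_contract {N : Matrix (K × L) (K × L) ℂ} (hN : N.PosSemidef) :
    (Matrix.of fun l l' => ∑ k, ∑ k', N (k, l) (k', l')).PosSemidef := by
  have h := hN.conjTranspose_mul_mul_same
    (Matrix.of fun (p : K × L) (l : L) => if p.2 = l then (1 : ℂ) else 0)
  convert h using 1
  ext l l'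
  simp only [Matrix.mul_apply, Fintype.sum_prod_type, conjTranspose_apply, of_apply,
    apply_ite star, star_one, star_zero, ite_mul, one_mul, zero_mul, mul_ite, mul_one, mul_zero,
    Finset.sum_ite_eq', Finset.mem_univ, if_true]
  rw [Finset.sum_comm]

/-- The output is the compression of O ⊗ M by the vector ∑ₖ |kk⟩ on the two copies of K: the
submatrix identifies the two copies and the contraction sums over k. The next two lemmas use the
same device. -/
theorem posSemidef_ampliate_choiInv {M : Matrix (K × L) (K × L) ℂ} {O : Matrix (K × B) (K × B) ℂ}
    (hM : M.PosSemidef) (hO : O.PosSemidef) : (ampliate (choiInv M) O).PosSemidef := by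
  have h := posSemidef_contract ((hO.kronecker hM).submatrix
    fun p : K × (L × B) => ((p.1, p.2.2), (p.1, p.2.1)))
  convert h using 1
  ext p q
  simp [ampliate_choiInv_apply]

theorem posSemidef_choiInv {M : Matrix (K × L) (K × L) ℂ} {O : Matrix K K ℂ}
    (hM : M.PosSemidef) (hO : O.PosSemidef) : (choiInv M O).PosSemidef := by
  have h := posSemidef_contract ((hO.kronecker hM).submatrix
    fun p : K × L => (p.1, (p.1, p.2)))
  convert h using 1
  ext p q
  simp [choiInv_apply]

theorem posSemidef_link {N : Matrix (K × B) (K × B) ℂ} {M : Matrix (B × L) (B × L) ℂ}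
    (hN : N.PosSemidef) (hM : M.PosSemidef) : (link N M).PosSemidef := by
  have h := posSemidef_contract ((hN.kronecker hM).submatrix
    fun p : B × (K × L) => ((p.2.1, p.1), (p.1, p.2.2)))
  convert h using 1
  ext p q
  simp [link_apply]

theorem posSemidef_trSnd {M : Matrix (K × L) (K × L) ℂ} (hM : M.PosSemidef) :
    (trSnd M).PosSemidef := by
  have h := posSemidef_sum Finset.univ fun (l : L) _ => hM.submatrix fun k : K => (k, l)
  convert h using 1
  ext p q
  simp [trSnd, Matrix.sum_apply]

theorem trace_trSnd (M : Matrix (K × L) (K × L) ℂ) : (trSnd M).trace = M.trace := by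
  simp [Matrix.trace, trSnd, Fintype.sum_prod_type]

theorem trSnd_ampliate_choiInv (M : Matrix (K × L) (K × L) ℂ) (O : Matrix (K × B) (K × B) ℂ) :
    trSnd (ampliate (choiInv M) O) = choiInv M (trSnd O) := by
  ext l l'
  simp only [trSnd, of_apply, ampliate_choiInv_apply, choiInv_apply, Finset.sum_mul]
  rw [Finset.sum_comm]
  exact Finset.sum_congr rfl fun k _ => Finset.sum_comm

theorem choiInv_smul_one_left (c : ℂ) (O : Matrix K K ℂ) :
    choiInv (c • (1 : Matrix (K × L) (K × L) ℂ)) O = (c * O.trace) • 1 := by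
  ext l l'
  simp only [choiInv_apply, Matrix.smul_apply, one_apply, Prod.mk.injEq, smul_eq_mul, Matrix.trace,
    diag_apply, mul_ite, mul_one, mul_zero]
  by_cases h : l = l'
  · simp [h, Finset.mul_sum, mul_comm]
  · simp [h]

theorem trace_choiInv_smul_one (M : Matrix (K × L) (K × L) ℂ) (c : ℂ) :
    (choiInv M (c • 1)).trace = c * M.trace := by
  simp only [Matrix.trace, diag_apply, choiInv_apply, Matrix.smul_apply, one_apply, smul_eq_mul, mul_ite,
    mul_one, mul_zero, ite_mul, zero_mul, Finset.sum_ite_eq, Finset.mem_univ, if_true,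
    Fintype.sum_prod_type, Finset.mul_sum]
  exact Finset.sum_comm

/-- The unnormalized projector on the maximally entangled vector of `K ⊗ B`. -/
def maxEnt (f : B ≃ K) : Matrix (K × B) (K × B) ℂ :=
  vecMulVec (fun p => if p.1 = f p.2 then 1 else 0) (fun p => if p.1 = f p.2 then 1 else 0)

theorem posSemidef_maxEnt (f : B ≃ K) : (maxEnt f).PosSemidef := by
  have h := posSemidef_vecMulVec_self_star fun p : K × B => if p.1 = f p.2 then (1 : ℂ) else 0
  have hs : star (fun p : K × B => if p.1 = f p.2 then (1 : ℂ) else 0) =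
      fun p => if p.1 = f p.2 then 1 else 0 := by
    funext p
    simp [apply_ite]
  rwa [hs] at h

/-- With P the projector and d the dimension, P² = dP, hence (d − P)² = d(d − P), and d − P is d⁻¹
times a square of a Hermitian operator. -/
theorem posSemidef_sub_maxEnt [Nonempty K] (f : B ≃ K) :
    ((Fintype.card K : ℂ) • (1 : Matrix (K × B) (K × B) ℂ) - maxEnt f).PosSemidef := by
  have hH : (maxEnt f)ᴴ = maxEnt f := (posSemidef_maxEnt f).isHermitian
  have hsq : maxEnt f * maxEnt f = (Fintype.card K : ℂ) • maxEnt f := by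
    have h : ∀ k, ∑ b, (if k = f b then (if k = f b then (1 : ℂ) else 0) else 0) = 1 := fun k => by
      rw [Finset.sum_eq_single (f.symm k)] <;> simp +contextual [← f.symm_apply_eq, eq_comm]
    ext p q
    simp [maxEnt, vecMulVec_mul_vecMulVec, dotProduct, Fintype.sum_prod_type, h]
  have hd : (Fintype.card K : ℂ) ≠ 0 := Nat.cast_ne_zero.2 Fintype.card_ne_zero
  have h := (posSemidef_conjTranspose_mul_self
    ((Fintype.card K : ℂ) • (1 : Matrix (K × B) (K × B) ℂ) - maxEnt f)).smul
    (inv_nonneg.2 (Nat.cast_nonneg (α := ℂ) (Fintype.card K)))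
  convert h using 1
  simp [sub_mul, mul_sub, hH, hsq, smul_smul, smul_sub, hd]

end Operators
-- Events of arrow types and extended maps
instance StrIdx.instNonempty : (w : List Sys) → Nonempty (StrIdx w)
  | [] => ⟨()⟩
  | A :: w => ⟨(⟨0, A.dim_pos⟩, (StrIdx.instNonempty w).some)⟩

instance Ty.instNonemptyIdx : (x : Ty) → Nonempty x.Idx
  | .str w => StrIdx.instNonempty w
  | .bist X u Y v => ⟨((⟨0, X.dim_pos⟩, (StrIdx.instNonempty u).some),
      (⟨0, Y.dim_pos⟩, (StrIdx.instNonempty v).some))⟩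
  | .arr x y => ⟨((instNonemptyIdx x).some, (instNonemptyIdx y).some)⟩

theorem mem_det_arr_iff {x y : Ty} {M : Op (.arr x y)} :
    M ∈ Det (.arr x y) ↔ ∀ E : Sys,
      (∀ O ∈ Adm (x.ext E), extMap M E O ∈ Adm (y.ext E)) ∧
      (∀ O ∈ Det (x.ext E), extMap M E O ∈ Det (y.ext E)) := by
  rw [Det]; rfl

theorem mem_adm_arr_iff {x y : Ty} {M : Op (.arr x y)} :
    M ∈ Adm (.arr x y) ↔
      (∀ E : Sys, ∀ O ∈ Adm (x.ext E), extMap M E O ∈ Adm (y.ext E)) ∧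
      ∃ (n : ℕ) (N : Fin n → Op (Ty.arr x y)),
        (∀ i, ∀ E : Sys, ∀ O ∈ Adm (x.ext E), extMap (N i) E O ∈ Adm (y.ext E)) ∧
        M + ∑ i, N i ∈ Det (.arr x y) := by
  rw [Adm]
  refine and_congr Iff.rfl (exists_congr fun n => exists_congr fun N => and_congr Iff.rfl ?_)
  rw [mem_det_arr_iff]
  exact forall_and.symm

theorem det_arr_subset_adm_arr (x y : Ty) : Det (.arr x y) ⊆ Adm (.arr x y) := fun M hM =>
  mem_adm_arr_iff.2 ⟨fun E => (mem_det_arr_iff.1 hM E).1, 0, Fin.elim0, fun i => i.elim0, by simpa⟩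

/-- The partial trace over the last tensor factor of an extended type. -/
def trExt {x : Ty} (E : Sys) (M : Op (x.ext E)) : Op x :=
  trSnd (reindex (Ty.extEquiv E x) (Ty.extEquiv E x) M)

theorem posSemidef_trExt {x : Ty} {E : Sys} {M : Op (x.ext E)} (hM : M.PosSemidef) :
    (trExt E M).PosSemidef :=
  posSemidef_trSnd (hM.submatrix _)

theorem trace_reindex_self {m n : Type} [Fintype m] [Fintype n] (e : m ≃ n) (M : Matrix m m ℂ) :
    (reindex e e M).trace = M.trace := by
  simpa [Matrix.trace] using Equiv.sum_comp e.symm fun i => M i i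

theorem trace_trExt {x : Ty} {E : Sys} (M : Op (x.ext E)) : (trExt E M).trace = M.trace := by
  rw [trExt, trace_trSnd, trace_reindex_self]

theorem posSemidef_extMap {x y : Ty} {M : Op (.arr x y)} {E : Sys} {O : Op (x.ext E)}
    (hM : M.PosSemidef) (hO : O.PosSemidef) : (extMap M E O).PosSemidef :=
  (posSemidef_ampliate_choiInv hM (hO.submatrix _)).submatrix _

theorem trExt_extMap {x y : Ty} (M : Op (.arr x y)) (E : Sys) (O : Op (x.ext E)) :
    trExt E (extMap M E O) = choiInv M (trExt E O) := by
  rw [trExt, trExt, ← trSnd_ampliate_choiInv, extMap]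
  congr 1
  ext i j
  simp

theorem extMap_sub_right {x y : Ty} (M : Op (.arr x y)) (E : Sys) (O O' : Op (x.ext E)) :
    extMap M E (O - O') = extMap M E O - extMap M E O' := by
  ext i j
  simp [extMap, ampliate_choiInv_apply, sub_mul]

theorem extMap_sub_left {x y : Ty} (M M' : Op (.arr x y)) (E : Sys) (O : Op (x.ext E)) :
    extMap (M - M') E O = extMap M E O - extMap M' E O := by
  ext i j
  simp [extMap, ampliate_choiInv_apply, mul_sub]

/-- A type none of whose operators is an event. -/
def Ty.IsVoid (x : Ty) : Prop := Det x = ∅ ∧ Adm x = ∅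

/-- A type all of whose operators are deterministic events. -/
def Ty.IsFull (x : Ty) : Prop := Det x = Set.univ ∧ Adm x = Set.univ

/-- A type whose deterministic events are positive, of constant trace, and include a positive
multiple of the identity, whose admissible events are the positive operators below a deterministic
one, and whose extensions are determined by the partial trace. -/
structure Ty.IsRegular (x : Ty) : Prop where
  posSemidef : ∀ M ∈ Det x, M.PosSemidef
  scale : ∃ c : ℂ, 0 < c ∧ c • (1 : Op x) ∈ Det x ∧ ∀ M ∈ Det x, M.trace = c * Fintype.card x.Idx
  mem_adm : ∀ M, M ∈ Adm x ↔ M.PosSemidef ∧ ∃ D ∈ Det x, (D - M).PosSemidef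
  mem_det_ext : ∀ (E : Sys) (M : Op (x.ext E)),
    M ∈ Det (x.ext E) ↔ M.PosSemidef ∧ trExt E M ∈ Det x

/-- `P` holds of the type `x` and of all its iterated extensions. -/
def Ty.Hereditarily (P : Ty → Prop) (x : Ty) : Prop := ∀ w : List Sys, P (w.foldl Ty.ext x)

-- Void, full and regular types under extensions and arrows

namespace Ty

theorem Hereditarily.self {P : Ty → Prop} {x : Ty} (h : Hereditarily P x) : P x := h []

theorem Hereditarily.ext {P : Ty → Prop} {x : Ty} (h : Hereditarily P x) (E : Sys) :
    Hereditarily P (x.ext E) := fun w => h (E :: w)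

theorem foldl_ext_str (u w : List Sys) : w.foldl Ty.ext (str u) = str (u ++ w) := by
  induction w generalizing u with
  | nil => simp
  | cons E w ih => simp [Ty.ext, ih]

theorem foldl_ext_bist (X : Sys) (u : List Sys) (Y : Sys) (v w : List Sys) :
    w.foldl Ty.ext (bist X u Y v) = bist X u Y (v ++ w) := by
  induction w generalizing v with
  | nil => simp
  | cons E w ih => simp [Ty.ext, ih]

theorem foldl_ext_arr (x y : Ty) (w : List Sys) :
    w.foldl Ty.ext (arr x y) = arr x (w.foldl Ty.ext y) := by
  induction w generalizing y with
  | nil => rfl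
  | cons E w ih => simp [Ty.ext, ih]

theorem Hereditarily.foldl {P : Ty → Prop} {x : Ty} (h : Hereditarily P x) (w : List Sys) :
    Hereditarily P (w.foldl Ty.ext x) := fun w' => by
  rw [← List.foldl_append]; exact h _

theorem hereditarily_arr {P Q : Ty → Prop} {x y : Ty} (hy : Hereditarily Q y)
    (h : ∀ z, Hereditarily Q z → P (arr x z)) : Hereditarily P (arr x y) := fun w => by
  rw [foldl_ext_arr]
  exact h _ (hy.foldl w)

theorem IsRegular.det_subset_adm {x : Ty} (h : x.IsRegular) : Det x ⊆ Adm x := fun M hM =>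
  (h.mem_adm M).2 ⟨h.posSemidef M hM, M, hM, by simpa using PosSemidef.zero⟩

theorem IsRegular.nonempty_adm {x : Ty} (h : x.IsRegular) : (Adm x).Nonempty :=
  let ⟨_, _, hc, _⟩ := h.scale
  ⟨_, h.det_subset_adm hc⟩

theorem IsRegular.zero_notMem_det {x : Ty} (h : x.IsRegular) : 0 ∉ Det x := fun h0 => by
  obtain ⟨c, hc, -, ht⟩ := h.scale
  have := ht 0 h0
  rw [trace_zero, eq_comm, mul_eq_zero] at this
  exact this.elim hc.ne' (by simp [Fintype.card_ne_zero])

theorem IsVoid.arr_isFull {x y : Ty} (hx : Hereditarily IsVoid x) : (arr x y).IsFull := by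
  have h : Det (arr x y) = Set.univ := Set.eq_univ_of_forall fun M =>
    mem_det_arr_iff.2 fun E => by simp [(hx.ext E).self.1, (hx.ext E).self.2]
  exact ⟨h, Set.univ_subset_iff.1 (h ▸ det_arr_subset_adm_arr x y)⟩

theorem IsFull.arr_isFull {x y : Ty} (hy : Hereditarily IsFull y) : (arr x y).IsFull := by
  have h : Det (arr x y) = Set.univ := Set.eq_univ_of_forall fun M =>
    mem_det_arr_iff.2 fun E => by simp [(hy.ext E).self.1, (hy.ext E).self.2]
  exact ⟨h, Set.univ_subset_iff.1 (h ▸ det_arr_subset_adm_arr x y)⟩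

theorem isVoid_arr_of_det_eq_empty {x y : Ty} (h : Det (arr x y) = ∅) : (arr x y).IsVoid :=
  ⟨h, Set.eq_empty_of_forall_notMem fun M hM => by
    obtain ⟨-, n, N, -, hN⟩ := mem_adm_arr_iff.1 hM
    simp [h] at hN⟩

/-- A linear map sends 0, deterministic in a full type, to 0, whose trace is wrong for a regular
type. -/
theorem IsFull.arr_isVoid {x y : Ty} (hx : Hereditarily IsFull x) (hy : Hereditarily IsRegular y) :
    (arr x y).IsVoid :=
  isVoid_arr_of_det_eq_empty <| Set.eq_empty_of_forall_notMem fun M hM => by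
    have h := (mem_det_arr_iff.1 hM Sys.triv).2 0 (by simp [(hx.ext Sys.triv).self.1])
    refine (hy.ext Sys.triv).self.zero_notMem_det ?_
    convert h using 1
    ext i j
    simp [extMap, ampliate_choiInv_apply]

theorem IsVoid.arr_isVoid {x y : Ty} (hx : ∀ E, (Adm (x.ext E)).Nonempty)
    (hy : Hereditarily IsVoid y) : (arr x y).IsVoid :=
  isVoid_arr_of_det_eq_empty <| Set.eq_empty_of_forall_notMem fun M hM => by
    obtain ⟨O, hO⟩ := hx Sys.triv
    have h := (mem_det_arr_iff.1 hM Sys.triv).1 O hO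
    simp [(hy.ext Sys.triv).self.2] at h

end Ty

-- Maps between regular types

/-- Choi's argument: extend by a copy E of the whole input space. A scaled maximally entangled
projector is admissible, and its image is M up to scale and the order of factors. -/
theorem posSemidef_of_preserves_adm {x y : Ty} (hx : Ty.Hereditarily Ty.IsRegular x)
    (hy : Ty.Hereditarily Ty.IsRegular y) {M : Op (.arr x y)}
    (h : ∀ E : Sys, ∀ O ∈ Adm (x.ext E), extMap M E O ∈ Adm (y.ext E)) : M.PosSemidef := by
  let E : Sys := ⟨Fintype.card x.Idx, Fintype.card_pos⟩
  let f : Fin E.dim ≃ x.Idx := (Fintype.equivFin x.Idx).symm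
  obtain ⟨c, hc, hcD, -⟩ := (hx.ext E).self.scale
  have hd : (0 : ℂ) < Fintype.card x.Idx := by exact_mod_cast Fintype.card_pos
  -- The projector is at most d times the identity, so the factor c / d puts it below the
  -- deterministic event c • 1 of `x.ext E`.
  let s : ℂ := c / Fintype.card x.Idx
  have hs : 0 < s := div_pos hc hd
  let O : Op (x.ext E) := s • (maxEnt f).submatrix (Ty.extEquiv E x) (Ty.extEquiv E x)
  have hO : O ∈ Adm (x.ext E) := by
    refine ((hx.ext E).self.mem_adm O).2 ⟨((posSemidef_maxEnt f).submatrix _).smul hs.le, _, hcD, ?_⟩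
    have := ((posSemidef_sub_maxEnt f).submatrix (Ty.extEquiv E x)).smul hs.le
    convert this using 1
    ext i j
    simp only [O, s, Matrix.sub_apply, Matrix.smul_apply, submatrix_apply, one_apply, smul_eq_mul,
      EmbeddingLike.apply_eq_iff_eq]
    field_simp
  have hP := (((hy.ext E).self.mem_adm _).1 (h E O hO)).1
  have hP' := (hP.submatrix fun p : x.Idx × y.Idx => (Ty.extEquiv E y).symm (p.2, f.symm p.1)).smul
    (inv_pos.2 hs).le
  convert hP' using 1
  ext p q
  simp [extMap, ampliate_choiInv_apply, O, maxEnt, vecMulVec_apply]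
  field_simp

/-- Tensoring with a one-dimensional system changes nothing; this brings conditions stated on
extensions back to `x` itself. -/
theorem exists_trExt_eq {x : Ty} {ρ : Op x} (hρ : ρ.PosSemidef) :
    ∃ O : Op (x.ext Sys.triv), O.PosSemidef ∧ trExt Sys.triv O = ρ := by
  refine ⟨ρ.submatrix (fun i => (Ty.extEquiv Sys.triv x i).1) fun i => (Ty.extEquiv Sys.triv x i).1,
    hρ.submatrix _, ?_⟩
  ext i j
  have : Fintype.card (Fin Sys.triv.dim) = 1 := rfl
  simp [trExt, trSnd, this]

/-- For regular types, the deterministic events of type `x → y` are the completely positive maps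
that send deterministic events to deterministic events. -/
theorem mem_det_arr_iff_of_isRegular {x y : Ty} (hx : Ty.Hereditarily Ty.IsRegular x)
    (hy : Ty.Hereditarily Ty.IsRegular y) {M : Op (.arr x y)} :
    M ∈ Det (.arr x y) ↔ M.PosSemidef ∧ ∀ ρ ∈ Det x, choiInv M ρ ∈ Det y := by
  constructor
  · intro hM
    rw [mem_det_arr_iff] at hM
    refine ⟨posSemidef_of_preserves_adm hx hy fun E => (hM E).1, fun ρ hρ => ?_⟩
    obtain ⟨O, hO, rfl⟩ := exists_trExt_eq (hx.self.posSemidef ρ hρ)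
    rw [← trExt_extMap]
    exact ((hy.self.mem_det_ext _ _).1
      ((hM _).2 O ((hx.self.mem_det_ext _ _).2 ⟨hO, hρ⟩))).2
  · rintro ⟨hM, h⟩
    have hdet : ∀ E, ∀ O ∈ Det (x.ext E), extMap M E O ∈ Det (y.ext E) := fun E O hO => by
      rw [hx.self.mem_det_ext] at hO
      rw [hy.self.mem_det_ext, trExt_extMap]
      exact ⟨posSemidef_extMap hM hO.1, h _ hO.2⟩
    refine mem_det_arr_iff.2 fun E => ⟨fun O hO => ?_, hdet E⟩
    obtain ⟨hO, D, hD, hDO⟩ := ((hx.ext E).self.mem_adm O).1 hO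
    refine ((hy.ext E).self.mem_adm _).2 ⟨posSemidef_extMap hM hO, _, hdet E D hD, ?_⟩
    rw [← extMap_sub_right]
    exact posSemidef_extMap hM hDO

-- Closure of regularity under arrows

namespace Ty

theorem card_idx_arr (x y : Ty) :
    Fintype.card (arr x y).Idx = Fintype.card x.Idx * Fintype.card y.Idx :=
  Fintype.card_prod x.Idx y.Idx

theorem trExt_choiInv {x y : Ty} (E : Sys) (M : Op ((arr x y).ext E)) (ρ : Op x) :
    trExt E (choiInv (K := x.Idx) (L := (y.ext E).Idx) M ρ) =
      choiInv (K := x.Idx) (L := y.Idx) (trExt E M) ρ := by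
  ext i j
  have h : ∀ e, choiInv (K := x.Idx) (L := (y.ext E).Idx) M ρ ((extEquiv E y).symm (i, e))
      ((extEquiv E y).symm (j, e)) = ∑ k, ∑ k', ρ k k' *
        M (k, (extEquiv E y).symm (i, e)) (k', (extEquiv E y).symm (j, e)) := fun e =>
    choiInv_apply (K := x.Idx) (L := (y.ext E).Idx) M ρ _ _
  refine (show _ = ∑ e, choiInv (K := x.Idx) (L := (y.ext E).Idx) M ρ
    ((extEquiv E y).symm (i, e)) ((extEquiv E y).symm (j, e)) from rfl).trans ?_
  simp only [h, trExt, trSnd, of_apply, reindex_apply, submatrix_apply, choiInv_apply,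
    Finset.mul_sum]
  rw [Finset.sum_comm]
  refine Finset.sum_congr rfl fun k _ => ?_
  rw [Finset.sum_comm]
  rfl

theorem IsRegular.arr_isRegular {x y : Ty} (hx : Hereditarily IsRegular x) (hy : Hereditarily IsRegular y) :
    (arr x y).IsRegular := by
  have hmem := fun M => mem_det_arr_iff_of_isRegular hx hy (M := M)
  have hpos : ∀ M ∈ Det (arr x y), M.PosSemidef := fun M hM => ((hmem M).1 hM).1
  refine ⟨hpos, ?_, fun M => ?_, fun E M => ?_⟩
  · obtain ⟨c, hc, hcx, htx⟩ := hx.self.scale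
    obtain ⟨d, hd, hdy, hty⟩ := hy.self.scale
    have hn : (0 : ℂ) < Fintype.card x.Idx := by exact_mod_cast Fintype.card_pos
    have hcn := mul_pos hc hn
    -- Every deterministic ρ has trace c|x|, so this multiple of the identity sends it to d • 1.
    refine ⟨d / (c * Fintype.card x.Idx), div_pos hd hcn,
      (hmem _).2 ⟨PosSemidef.one.smul (div_pos hd hcn).le, fun ρ hρ => ?_⟩, fun M hM => ?_⟩
    · have h := choiInv_smul_one_left (K := x.Idx) (L := y.Idx) (d / (c * Fintype.card x.Idx)) ρ
      rw [htx ρ hρ, div_mul_cancel₀ _ hcn.ne'] at h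
      have hdy' := h ▸ hdy
      convert hdy' using 1
    -- Evaluating M at the deterministic event c • 1 gives c Tr M = d|y|, which fixes Tr M.
    · have h := hty _ (((hmem M).1 hM).2 _ hcx)
      have h' := trace_choiInv_smul_one (K := x.Idx) (L := y.Idx) M c
      have h'' := h'.symm.trans h
      rw [card_idx_arr, Nat.cast_mul]
      field_simp
      rw [mul_comm, h'']
  · constructor
    · intro hM
      obtain ⟨hM, n, N, hN, hD⟩ := mem_adm_arr_iff.1 hM
      refine ⟨posSemidef_of_preserves_adm hx hy hM, _, hD, ?_⟩
      rw [add_sub_cancel_left]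
      exact posSemidef_sum _ fun i _ => posSemidef_of_preserves_adm hx hy (hN i)
    · rintro ⟨hM, D, hD, hDM⟩
      -- For O ≤ D', the image of O under N lies below that of D' under D: D(D') − N(O) = D(D' − O)
      -- + (D − N)(O).
      have key : ∀ N : Op (.arr x y), N.PosSemidef → (D - N).PosSemidef →
          ∀ E : Sys, ∀ O ∈ Adm (x.ext E), extMap N E O ∈ Adm (y.ext E) := by
        intro N hN hDN E O hO
        obtain ⟨hO, D', hD', hDO⟩ := ((hx.ext E).self.mem_adm O).1 hO
        refine ((hy.ext E).self.mem_adm _).2 ⟨posSemidef_extMap hN hO, _,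
          (mem_det_arr_iff.1 hD E).2 D' hD', ?_⟩
        have h := (posSemidef_extMap (hpos D hD) hDO).add (posSemidef_extMap hDN hO)
        rw [extMap_sub_left, extMap_sub_right] at h
        simpa using h
      refine mem_adm_arr_iff.2 ⟨key M hM hDM, 1, fun _ => D - M,
        fun _ => key _ hDM (by simpa using hM), by simpa using hD⟩
  -- Extending an arrow extends only its codomain, and discarding E commutes with applying the map.
  · refine (mem_det_arr_iff_of_isRegular hx (hy.ext E) (M := M)).trans (Iff.trans ?_
      (and_congr_right' (hmem (trExt E M)).symm))
    constructor
    · rintro ⟨hM, h⟩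
      refine ⟨hM, posSemidef_trExt hM, fun ρ hρ => ?_⟩
      rw [← trExt_choiInv]
      exact ((hy.self.mem_det_ext _ _).1 (h ρ hρ)).2
    · rintro ⟨hM, -, h⟩
      refine ⟨hM, fun ρ hρ => (hy.self.mem_det_ext _ _).2
        ⟨posSemidef_choiInv hM (hx.self.posSemidef ρ hρ), ?_⟩⟩
      have := h ρ hρ
      rwa [← trExt_choiInv] at this

-- Elementary types and the trichotomy

theorem isRegular_str (w : List Sys) : (str w).IsRegular := by
  have hmem : ∀ w (M : Op (str w)), M ∈ Det (str w) ↔ M.PosSemidef ∧ M.trace = 1 := fun w M => by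
    rw [Det]; rfl
  have hn : (0 : ℂ) < Fintype.card (str w).Idx := by exact_mod_cast Fintype.card_pos
  refine ⟨fun M hM => ((hmem w M).1 hM).1, ⟨_, inv_pos.2 hn, (hmem w _).2
    ⟨PosSemidef.one.smul (inv_pos.2 hn).le, ?_⟩, fun M hM => ?_⟩, fun M => ?_, fun E M => ?_⟩
  · rw [trace_smul, trace_one, smul_eq_mul, inv_mul_cancel₀ hn.ne']
  · rw [inv_mul_cancel₀ hn.ne']
    exact ((hmem w M).1 hM).2
  · rw [Adm]; rfl
  · rw [hmem w, trace_trExt]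
    exact (hmem (w ++ [E]) M).trans
      ⟨fun h => ⟨h.1, posSemidef_trExt h.1, h.2⟩, fun h => ⟨h.1, h.2.2⟩⟩

theorem mem_det_bist_iff {X : Sys} {u : List Sys} {Y : Sys} {v : List Sys}
    {M : Op (bist X u Y v)} : M ∈ Det (bist X u Y v) ↔ IsBistochasticChannel M := by
  rw [Det]; rfl

/-- The two normalizations compute Tr M as dim X · dim u and as dim u · dim Y. -/
theorem isVoid_bist {X Y : Sys} (h : X.dim ≠ Y.dim) (u v : List Sys) :
    (bist X u Y v).IsVoid := by
  have hD : Det (bist X u Y v) = ∅ := Set.eq_empty_of_forall_notMem fun M hM => by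
    obtain ⟨-, h1, h2⟩ := mem_det_bist_iff.1 hM
    have h3 := congrArg trace h1
    have h4 := congrArg trace h2
    rw [trace_one] at h3 h4
    have h5 : (Fintype.card (Fin X.dim × StrIdx u) : ℂ) = Fintype.card (StrIdx u × Fin Y.dim) := by
      rw [← h3, ← h4]
      simp only [trace, diag_apply, trSnd, of_apply, Fintype.sum_prod_type]
      rw [Finset.sum_comm]
      refine Finset.sum_congr rfl fun a _ => ?_
      rw [Finset.sum_comm]
    simp only [Fintype.card_prod, Fintype.card_fin] at h5
    norm_cast at h5
    rw [mul_comm] at h5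
    exact h (Nat.eq_of_mul_eq_mul_left Fintype.card_pos h5)
  refine ⟨hD, Set.eq_empty_of_forall_notMem fun M hM => ?_⟩
  rw [Adm] at hM
  obtain ⟨-, D, hD', -⟩ := hM
  simp [hD] at hD'

/-- E is appended to `v`, which both normalizations trace out, so neither changes when E is
discarded first. -/
theorem trSnd_trExt_bist {X : Sys} {u : List Sys} {Y : Sys} {v : List Sys} (E : Sys)
    (M : Op (bist X u Y (v ++ [E]))) :
    trSnd (K := Fin X.dim × StrIdx u) (L := Fin Y.dim × StrIdx v)
        (trExt (x := bist X u Y v) E M) =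
      trSnd (K := Fin X.dim × StrIdx u) (L := Fin Y.dim × StrIdx (v ++ [E])) M := by
  ext k k'
  simp only [trSnd, trExt, of_apply, Fintype.sum_prod_type]
  refine Finset.sum_congr rfl fun a _ => ?_
  rw [← Equiv.sum_comp (snocEquiv E v).symm, Fintype.sum_prod_type]
  rfl

theorem sum_trExt_bist {X : Sys} {u : List Sys} {Y : Sys} {v : List Sys} (E : Sys)
    (M : Op (bist X u Y (v ++ [E]))) (p q : StrIdx u × Fin Y.dim) :
    ∑ t : Fin X.dim × StrIdx v, trExt (x := bist X u Y v) E M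
        ((t.1, p.1), (p.2, t.2)) ((t.1, q.1), (q.2, t.2)) =
      ∑ t : Fin X.dim × StrIdx (v ++ [E]), M ((t.1, p.1), (p.2, t.2)) ((t.1, q.1), (q.2, t.2)) := by
  simp only [trSnd, trExt, of_apply, Fintype.sum_prod_type]
  refine Finset.sum_congr rfl fun a _ => ?_
  rw [← Equiv.sum_comp (snocEquiv E v).symm, Fintype.sum_prod_type]
  rfl

theorem isRegular_bist {X Y : Sys} (h : X.dim = Y.dim) (u v : List Sys) :
    (bist X u Y v).IsRegular := by
  have hn : (0 : ℂ) < Fintype.card (Fin Y.dim × StrIdx v) := by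
    have : Nonempty (Fin Y.dim) := ⟨⟨0, Y.dim_pos⟩⟩
    exact_mod_cast Fintype.card_pos
  refine ⟨fun M hM => (mem_det_bist_iff.1 hM).1, ⟨_, inv_pos.2 hn, mem_det_bist_iff.2
    ⟨PosSemidef.one.smul (inv_pos.2 hn).le, ?_, ?_⟩, fun M hM => ?_⟩, fun M => ?_, fun E M => ?_⟩
  · ext k k'
    by_cases hk : k = k'
    · subst hk
      refine Eq.trans ?_ (one_apply_eq _).symm
      simpa [trSnd] using mul_inv_cancel₀ hn.ne'
    · simp [trSnd, hk]
  · ext p q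
    by_cases hp : p = q
    · subst hp
      refine Eq.trans ?_ (one_apply_eq _).symm
      simpa [h] using mul_inv_cancel₀ hn.ne'
    · have hp' : ∀ t : Fin X.dim × StrIdx v,
          (((t.1, p.1), (p.2, t.2)) : (Fin X.dim × StrIdx u) × (Fin Y.dim × StrIdx v)) ≠
            ((t.1, q.1), (q.2, t.2)) := fun t ht => hp (by simpa [Prod.ext_iff] using ht)
      simp [hp, hp']
  · have ht := congrArg trace (mem_det_bist_iff.1 hM).2.1
    rw [trace_trSnd, trace_one] at ht
    have hc : Fintype.card (bist X u Y v).Idx =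
        Fintype.card (Fin X.dim × StrIdx u) * Fintype.card (Fin Y.dim × StrIdx v) :=
      Fintype.card_prod (Fin X.dim × StrIdx u) (Fin Y.dim × StrIdx v)
    rw [hc, Nat.cast_mul, mul_left_comm, inv_mul_cancel₀ hn.ne', mul_one]
    exact ht
  · rw [Adm]; rfl
  · have h₁ := trSnd_trExt_bist E M
    have h₂ := congrArg Matrix.of (funext₂ (sum_trExt_bist E M))
    refine (mem_det_bist_iff (M := M)).trans ⟨fun hM => ⟨hM.1, mem_det_bist_iff.2
      ⟨posSemidef_trExt hM.1, h₁.trans hM.2.1, h₂.trans hM.2.2⟩⟩, fun hM => ?_⟩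
    obtain ⟨-, h₃, h₄⟩ := mem_det_bist_iff.1 hM.2
    exact ⟨hM.1, h₁.symm.trans h₃, h₂.symm.trans h₄⟩

/-- Every type is void, full or regular, in the same way as all its extensions. -/
theorem trichotomy (x : Ty) :
    Hereditarily IsVoid x ∨ Hereditarily IsFull x ∨ Hereditarily IsRegular x := by
  induction x with
  | str u => exact .inr (.inr fun w => foldl_ext_str u w ▸ isRegular_str _)
  | bist X u Y v =>
    by_cases h : X.dim = Y.dim
    · exact .inr (.inr fun w => foldl_ext_bist X u Y v w ▸ isRegular_bist h _ _)
    · exact .inl fun w => foldl_ext_bist X u Y v w ▸ isVoid_bist h _ _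
  | arr x y ihx ihy =>
    rcases ihx with hx | hx
    -- A void domain makes the conditions vacuous whatever the codomain, hence the trivial predicate
    -- on it.
    · exact .inr (.inl (hereditarily_arr (Q := fun _ => True) (fun _ => trivial)
        fun z _ => IsVoid.arr_isFull hx))
    · rcases ihy with hy | hy | hy
      · refine .inl (hereditarily_arr hy fun z hz => IsVoid.arr_isVoid (fun E => ?_) hz)
        rcases hx with hx | hx
        · rw [(hx.ext E).self.2]
          exact Set.univ_nonempty
        · exact (hx.ext E).self.nonempty_adm
      · exact .inr (.inl (hereditarily_arr hy fun z hz => IsFull.arr_isFull hz))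
      · rcases hx with hx | hx
        · exact .inl (hereditarily_arr hy fun z hz => IsFull.arr_isVoid hx hz)
        · exact .inr (.inr (hereditarily_arr hy fun z hz => IsRegular.arr_isRegular hx hz))

end Ty

-- Evaluating the link product on events

theorem linkComp_apply {x y : Ty} {A B C : List Sys} (R : Op (toChan x A B))
    (S : Op (toChan y B C)) (p q : (x.Idx × StrIdx A) × (y.Idx × StrIdx C)) :
    linkComp R S (compEquiv x y A C p) (compEquiv x y A C q) =
      ∑ b, ∑ b', R (p.1.1, (p.1.2, b)) (q.1.1, (q.1.2, b')) *
        S (p.2.1, (b, p.2.2)) (q.2.1, (b', q.2.2)) := by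
  simp [linkComp, link_apply]

theorem posSemidef_linkComp {x y : Ty} {A B C : List Sys} {R : Op (toChan x A B)}
    {S : Op (toChan y B C)} (hR : R.PosSemidef) (hS : S.PosSemidef) :
    (linkComp R S).PosSemidef := by
  rw [linkComp, reindex_apply]
  refine PosSemidef.submatrix (posSemidef_link ?_ ?_) _
  · exact hR.submatrix _
  · exact hS.submatrix _

theorem mem_det_str_iff {w : List Sys} {M : Op (.str w)} :
    M ∈ Det (.str w) ↔ M.PosSemidef ∧ M.trace = 1 := by
  rw [Det]; rfl

section Effects

variable {x y : Ty} {A B C : List Sys}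

/-- The operator `L * (a ⊗ 𝟙_C)` of type `x → ȳ` obtained from an operator `L` of type
`(x ⊗ y) → (A → C)` by inserting an operator `a` on `A` and discarding `C`. -/
def insertDiscard (L : Op (toChan (x.tensor y) A C)) (a : Op (.str A)) : Op (.arr x y.bar) :=
  Matrix.of fun p q => ∑ c : StrIdx C, ∑ i : StrIdx A, ∑ j : StrIdx A, a i j *
    L (compEquiv x y A C ((p.1, i), (p.2.1, c))) (compEquiv x y A C ((q.1, j), (q.2.1, c)))

theorem posSemidef_insertDiscard {L : Op (toChan (x.tensor y) A C)} {a : Op (.str A)}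
    (hL : L.PosSemidef) (ha : a.PosSemidef) : (insertDiscard L a).PosSemidef := by
  have h := posSemidef_sum Finset.univ fun (c : StrIdx C) _ =>
    posSemidef_contract ((ha.kronecker hL).submatrix
      fun p : StrIdx A × (Ty.arr x y.bar).Idx =>
        (p.1, compEquiv x y A C ((p.2.1, p.1), (p.2.2.1, c))))
  convert h using 1
  ext p q
  simp [insertDiscard, Matrix.sum_apply]

instance Ty.instUniqueIdxTriv : Unique Ty.triv.Idx where
  default := ((0 : Fin 1), ())
  uniq _ := Prod.ext (Subsingleton.elim (α := Fin 1) _ _) rfl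

theorem trace_triv (M : Op Ty.triv) : M.trace = M default default :=
  Fintype.sum_unique _

theorem compEquiv_apply (p : (Ty.arr x y.bar).Idx) (i : StrIdx A) (c : StrIdx C) :
    compEquiv x y A C ((p.1, i), (p.2.1, c)) = ((p, default), (i, c)) := by
  obtain ⟨k, l, t⟩ := p
  rw [Subsingleton.elim t (default : Ty.triv.Idx)]
  rfl

theorem insertDiscard_apply (L : Op (toChan (x.tensor y) A C)) (a : Op (.str A))
    (p q : (Ty.arr x y.bar).Idx) :
    insertDiscard L a p q = ∑ c : StrIdx C, ∑ i : StrIdx A, ∑ j : StrIdx A,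
      a i j * L ((p, default), (i, c)) ((q, default), (j, c)) :=
  Finset.sum_congr rfl fun c _ => Finset.sum_congr rfl fun i _ => Finset.sum_congr rfl fun j _ =>
    congrArg (a i j * ·) (congrArg₂ L (compEquiv_apply p i c) (compEquiv_apply q j c))

theorem insertDiscard_linkComp_apply (R : Op (toChan x A B)) (S : Op (toChan y B C))
    (a : Op (.str A)) (k k' : x.Idx) (l l' : y.Idx) :
    insertDiscard (linkComp R S) a (k, (l, default)) (k', (l', default)) =
      ∑ c : StrIdx C, ∑ i : StrIdx A, ∑ j : StrIdx A, a i j * ∑ b, ∑ b',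
        R (k, (i, b)) (k', (j, b')) * S (l, (b, c)) (l', (b', c)) :=
  Finset.sum_congr rfl fun c _ => Finset.sum_congr rfl fun i _ => Finset.sum_congr rfl fun j _ =>
    congrArg (a i j * ·) (linkComp_apply R S ((k, i), (l, c)) ((k', j), (l', c)))

/-- Both sides are the full contraction of L with T, a and 𝟙_C, performed in different orders. -/
theorem trace_choiInv_insertDiscard (L : Op (toChan (x.tensor y) A C)) (T : Op (x.tensor y))
    (a : Op (.str A)) :
    (choiInv (K := (Ty.arr x y.bar).Idx) (L := Ty.triv.Idx) T (insertDiscard L a)).trace =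
      (choiInv (K := StrIdx A) (L := StrIdx C)
        (choiInv (K := (x.tensor y).Idx) (L := StrIdx A × StrIdx C) L T) a).trace := by
  let g (p q : (Ty.arr x y.bar).Idx) (c : StrIdx C) (i j : StrIdx A) : ℂ :=
    a i j * (T (p, default) (q, default) *
      L ((p, default), (i, c)) ((q, default), (j, c)))
  trans ∑ p, ∑ q, ∑ c, ∑ i, ∑ j, g p q c i j
  · rw [trace_triv]
    refine (choiInv_apply (K := (Ty.arr x y.bar).Idx) (L := Ty.triv.Idx) T _ _ _).trans ?_
    refine Finset.sum_congr rfl fun p _ => Finset.sum_congr rfl fun q _ => ?_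
    rw [insertDiscard_apply, mul_comm]
    simp only [Finset.mul_sum, g]
    refine Finset.sum_congr rfl fun c _ => Finset.sum_congr rfl fun i _ =>
      Finset.sum_congr rfl fun j _ => ?_
    ring
  · trans ∑ c, ∑ i, ∑ j, ∑ p, ∑ q, g p q c i j
    · trans ∑ s : (Ty.arr x y.bar).Idx × (Ty.arr x y.bar).Idx,
          ∑ t : StrIdx C × StrIdx A × StrIdx A, g s.1 s.2 t.1 t.2.1 t.2.2
      · simp only [Fintype.sum_prod_type]
      · rw [Finset.sum_comm]
        simp only [Fintype.sum_prod_type]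
    · refine Finset.sum_congr rfl fun c _ => ?_
      rw [diag_apply, choiInv_apply]
      refine Finset.sum_congr rfl fun i _ => Finset.sum_congr rfl fun j _ => ?_
      simp only [g, ← Finset.mul_sum]
      congr 1
      refine Eq.trans ?_ (choiInv_apply (K := (x.tensor y).Idx) (L := StrIdx A × StrIdx C)
        L T (i, c) (j, c)).symm
      have hsum : ∀ f : (x.tensor y).Idx → ℂ, ∑ P, f P = ∑ p, f (p, default) := fun f =>
        (Fintype.sum_prod_type (α₁ := (Ty.arr x y.bar).Idx) (α₂ := Ty.triv.Idx) f).trans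
          (Finset.sum_congr rfl fun p _ => Fintype.sum_unique _)
      simp only [hsum]

/-- Associativity of contraction in scalar form. In the application Y, X, I and B are sets of pairs
of a row and a column index, while C is a single index because it is traced out. -/
theorem sum_mul_sum_mul_sum_comm {Y X C I B : Type} [Fintype Y] [Fintype X] [Fintype C] [Fintype I]
    [Fintype B] (σ : Y → ℂ) (ρ : X → ℂ) (a : I → ℂ) (R : X → I → B → ℂ) (S : Y → B → C → ℂ) :
    ∑ y, σ y * ∑ x, ρ x * ∑ c, ∑ i, a i * ∑ b, R x i b * S y b c =
      ∑ c, ∑ b, (∑ i, a i * ∑ x, ρ x * R x i b) * ∑ y, σ y * S y b c := by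
  let g (y x c i b) : ℂ := σ y * ρ x * a i * R x i b * S y b c
  trans ∑ y, ∑ x, ∑ c, ∑ i, ∑ b, g y x c i b
  · simp only [Finset.mul_sum, g, mul_assoc]
  · trans ∑ c, ∑ b, ∑ i, ∑ x, ∑ y, g y x c i b
    · let e : Y × X × C × I × B ≃ C × B × I × X × Y :=
        ⟨fun t => (t.2.2.1, t.2.2.2.2, t.2.2.2.1, t.2.1, t.1),
          fun t => (t.2.2.2.2, t.2.2.2.1, t.1, t.2.2.1, t.2.1), fun _ => rfl, fun _ => rfl⟩
      have h := Equiv.sum_comp e fun t => g t.2.2.2.2 t.2.2.2.1 t.1 t.2.2.1 t.2.1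
      simp only [Fintype.sum_prod_type] at h
      exact h
    · refine Finset.sum_congr rfl fun c _ => Finset.sum_congr rfl fun b _ => ?_
      rw [Finset.sum_mul]
      refine Finset.sum_congr rfl fun i _ => ?_
      rw [mul_assoc, Finset.sum_mul, Finset.mul_sum]
      refine Finset.sum_congr rfl fun x _ => ?_
      rw [Finset.mul_sum, Finset.mul_sum]
      refine Finset.sum_congr rfl fun y _ => ?_
      simp only [g]
      ring

/-- Once ρ and σ are fixed, the link over B becomes sequential composition of R(ρ) and S(σ). -/
theorem trace_choiInv_insertDiscard_linkComp (R : Op (toChan x A B)) (S : Op (toChan y B C))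
    (a : Op (.str A)) (ρ : Op x) (σ : Op y) :
    (choiInv (K := y.Idx) (L := Ty.triv.Idx) (choiInv (K := x.Idx) (L := y.bar.Idx)
        (insertDiscard (linkComp R S) a) ρ) σ).trace =
      (choiInv (K := StrIdx B) (L := StrIdx C) (choiInv (K := y.Idx) (L := StrIdx B × StrIdx C) S σ)
        (choiInv (K := StrIdx A) (L := StrIdx B)
          (choiInv (K := x.Idx) (L := StrIdx A × StrIdx B) R ρ) a)).trace := by
  have h := sum_mul_sum_mul_sum_comm (fun s : y.Idx × y.Idx => σ s.1 s.2)
    (fun s : x.Idx × x.Idx => ρ s.1 s.2) (fun s : StrIdx A × StrIdx A => a s.1 s.2)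
    (fun (s : x.Idx × x.Idx) (i : StrIdx A × StrIdx A) (b : StrIdx B × StrIdx B) =>
      R (s.1, (i.1, b.1)) (s.2, (i.2, b.2)))
    (fun (s : y.Idx × y.Idx) (b : StrIdx B × StrIdx B) (c : StrIdx C) =>
      S (s.1, (b.1, c)) (s.2, (b.2, c)))
  simp only [Fintype.sum_prod_type] at h
  rw [trace_triv]
  refine (choiInv_apply (K := y.Idx) (L := Ty.triv.Idx) _ σ _ _).trans ?_
  have h' : ∀ l l' : y.Idx, choiInv (K := x.Idx) (L := y.bar.Idx)
      (insertDiscard (linkComp R S) a) ρ (l, default) (l', default) =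
      ∑ k, ∑ k', ρ k k' * ∑ c : StrIdx C, ∑ i : StrIdx A, ∑ j : StrIdx A, a i j * ∑ b, ∑ b',
        R (k, (i, b)) (k', (j, b')) * S (l, (b, c)) (l', (b', c)) := fun l l' =>
    (choiInv_apply (K := x.Idx) (L := y.bar.Idx) _ ρ _ _).trans <|
      Finset.sum_congr rfl fun k _ => Finset.sum_congr rfl fun k' _ =>
        congrArg (ρ k k' * ·) (insertDiscard_linkComp_apply R S a k k' l l')
  simp only [h', Matrix.trace, diag_apply, choiInv_apply]
  exact h

end Effects

-- Composition and networks

namespace Ty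

theorem hereditarily_isRegular_str (w : List Sys) : Hereditarily IsRegular (str w) := fun w' =>
  foldl_ext_str w w' ▸ isRegular_str _

theorem Hereditarily.isRegular_arr {x y : Ty} (hx : Hereditarily IsRegular x)
    (hy : Hereditarily IsRegular y) : Hereditarily IsRegular (arr x y) :=
  hereditarily_arr hy fun _ hz => IsRegular.arr_isRegular hx hz

theorem Hereditarily.isFull_arr {x y : Ty} (hy : Hereditarily IsFull y) :
    Hereditarily IsFull (arr x y) :=
  hereditarily_arr hy fun _ hz => IsFull.arr_isFull hz

theorem Hereditarily.isFull_arr_of_isVoid {x y : Ty} (hx : Hereditarily IsVoid x) :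
    Hereditarily IsFull (arr x y) :=
  hereditarily_arr (Q := fun _ => True) (fun _ => trivial) fun _ _ => IsVoid.arr_isFull hx

theorem Hereditarily.isVoid_bar {x : Ty} (hx : Hereditarily IsFull x) :
    Hereditarily IsVoid x.bar :=
  hereditarily_arr (hereditarily_isRegular_str _) fun _ hz => IsFull.arr_isVoid hx hz

end Ty

theorem linkComp_mem_det_of_isRegular {x y : Ty} {A B C : List Sys}
    (hx : Ty.Hereditarily Ty.IsRegular x) (hy : Ty.Hereditarily Ty.IsRegular y)
    {R : Op (toChan x A B)} {S : Op (toChan y B C)}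
    (hR : R ∈ Det (toChan x A B)) (hS : S ∈ Det (toChan y B C)) :
    linkComp R S ∈ Det (toChan (x.tensor y) A C) := by
  have hstr := Ty.hereditarily_isRegular_str
  have hchan := fun A B => (hstr A).isRegular_arr (hstr B)
  have hybar : Ty.Hereditarily Ty.IsRegular y.bar := hy.isRegular_arr (hstr _)
  have hxy : Ty.Hereditarily Ty.IsRegular (.arr x y.bar) := hx.isRegular_arr hybar
  have hT : Ty.Hereditarily Ty.IsRegular (x.tensor y) := hxy.isRegular_arr (hstr _)
  obtain ⟨hRpos, hR⟩ := (mem_det_arr_iff_of_isRegular hx (hchan A B)).1 hR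
  obtain ⟨hSpos, hS⟩ := (mem_det_arr_iff_of_isRegular hy (hchan B C)).1 hS
  have hL := posSemidef_linkComp hRpos hSpos
  refine (mem_det_arr_iff_of_isRegular hT (hchan A C)).2 ⟨hL, fun T hTdet => ?_⟩
  have hLT := posSemidef_choiInv hL (hT.self.posSemidef T hTdet)
  refine (mem_det_arr_iff_of_isRegular (hstr A) (hstr C)).2 ⟨hLT, fun a ha => ?_⟩
  have hapos := (mem_det_str_iff.1 ha).1
  refine mem_det_str_iff.2 ⟨posSemidef_choiInv hLT hapos, ?_⟩
  -- The heart of the argument: this operator pairs to 1 with all deterministic ρ and σ, so the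
  -- functional T must take the value 1 on it.
  have hLa : insertDiscard (linkComp R S) a ∈ Det (.arr x y.bar) := by
    have hpos := posSemidef_insertDiscard hL hapos
    refine (mem_det_arr_iff_of_isRegular hx hybar).2 ⟨hpos, fun ρ hρ => ?_⟩
    have hpos' := posSemidef_choiInv hpos (hx.self.posSemidef ρ hρ)
    refine (mem_det_arr_iff_of_isRegular hy (hstr _)).2 ⟨hpos', fun σ hσ => ?_⟩
    refine mem_det_str_iff.2 ⟨posSemidef_choiInv hpos' (hy.self.posSemidef σ hσ), ?_⟩
    refine (trace_choiInv_insertDiscard_linkComp R S a ρ σ).trans ?_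
    exact (mem_det_str_iff.1 (((mem_det_arr_iff_of_isRegular (hstr B) (hstr C)).1 (hS σ hσ)).2 _
      (((mem_det_arr_iff_of_isRegular (hstr A) (hstr B)).1 (hR ρ hρ)).2 a ha))).2
  have h := ((mem_det_arr_iff_of_isRegular hxy (hstr _)).1 hTdet).2 _ hLa
  exact (trace_choiInv_insertDiscard (linkComp R S) T a).symm.trans (mem_det_str_iff.1 h).2

theorem linkComp_mem_det {x y : Ty} {A B C : List Sys} {R : Op (toChan x A B)}
    {S : Op (toChan y B C)} (hR : R ∈ Det (toChan x A B)) (hS : S ∈ Det (toChan y B C)) :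
    linkComp R S ∈ Det (toChan (x.tensor y) A C) := by
  have hchan : ∀ A B, Ty.Hereditarily Ty.IsRegular (.arr (.str A) (.str B)) := fun A B =>
    (Ty.hereditarily_isRegular_str A).isRegular_arr (Ty.hereditarily_isRegular_str B)
  -- If `x → ȳ` is full, its functionals `x ⊗ y` form a void type, and every operator with that
  -- domain is deterministic.
  have hfull : Ty.Hereditarily Ty.IsFull (.arr x y.bar) →
      linkComp R S ∈ Det (toChan (x.tensor y) A C) := fun h =>
    Set.eq_univ_iff_forall.1
      (Ty.IsVoid.arr_isFull (y := .arr (.str A) (.str C)) h.isVoid_bar).1 _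
  rcases x.trichotomy with hx | hx | hx
  · exact hfull (Ty.Hereditarily.isFull_arr_of_isVoid hx)
  · simp [(Ty.IsFull.arr_isVoid hx (hchan A B)).1] at hR
  · rcases y.trichotomy with hy | hy | hy
    · exact hfull (Ty.Hereditarily.isFull_arr (Ty.Hereditarily.isFull_arr_of_isVoid hy))
    · simp [(Ty.IsFull.arr_isVoid hy (hchan B C)).1] at hS
    · exact linkComp_mem_det_of_isRegular hx hy hR hS

theorem network_mem_det {t : ℕ → Ty} {E : ℕ → List Sys}
    (M : ∀ i, Op (toChan (t i) (E i) (E (i + 1)))) (n : ℕ)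
    (hM : ∀ i ≤ n, M i ∈ Det (toChan (t i) (E i) (E (i + 1)))) :
    network M n ∈ Det (toChan (tensorSeq t n) (E 0) (E (n + 1))) := by
  induction n with
  | zero => exact hM 0 le_rfl
  | succ n ih => exact linkComp_mem_det (ih fun i hi => hM i (hi.trans n.le_succ)) (hM _ le_rfl)

end HigherOrder

theorem mainTheorem5 :
    (∀ (x y : HigherOrder.Ty) (A B C : List HigherOrder.Sys)
      (R : HigherOrder.Op (HigherOrder.toChan x A B))
      (S : HigherOrder.Op (HigherOrder.toChan y B C)),
      R ∈ HigherOrder.Det (HigherOrder.toChan x A B) →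
      S ∈ HigherOrder.Det (HigherOrder.toChan y B C) →
      HigherOrder.linkComp R S ∈
        HigherOrder.Det (HigherOrder.toChan (HigherOrder.Ty.tensor x y) A C)) ∧
    (∀ (n : ℕ) (x : ℕ → HigherOrder.Ty) (E : ℕ → List HigherOrder.Sys)
      (M : ∀ i, HigherOrder.Op (HigherOrder.toChan (x i).bar (E i) (E (i + 1)))),
      (∀ i ≤ n, M i ∈ HigherOrder.Det (HigherOrder.toChan (x i).bar (E i) (E (i + 1)))) →
      HigherOrder.network (t := fun i => (x i).bar) (E := E) M n ∈
          HigherOrder.Det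
            (HigherOrder.toChan
              (HigherOrder.tensorSeq (fun i => (x i).bar) n) (E 0) (E (n + 1))) ∧
        HigherOrder.network (t := fun i => (x i).bar) (E := E) M n ∈
          HigherOrder.Adm
            (HigherOrder.toChan
              (HigherOrder.tensorSeq (fun i => (x i).bar) n) (E 0) (E (n + 1)))) := by
  refine ⟨fun x y A B C R S hR hS => HigherOrder.linkComp_mem_det hR hS, fun n x E M hM => ?_⟩
  -- Indices run from 0 to n, so there are n + 1 maps. The bars play no role: the network result
  -- holds for arbitrary input types.
  have h := HigherOrder.network_mem_det (t := fun i => (x i).bar) M n hM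
  exact ⟨h, HigherOrder.det_arr_subset_adm_arr _ _ h⟩
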